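/- Let $d\ge 1$ and $b\ge 2$ be integers, let $A\in\mathbb{R}^{d\times d}$, let $\sigma(B)\subset\mathbb{C}$ denote the set of all complex eigenvalues of a real square matrix $B$, and let $|\cdot|$ denote the Euclidean norm on $\mathbb{R}^d$. If $\sigma(A^N)$ is $b$-nonresonant for some integer $N\ge 1$, then for every $x\in\mathbb{R}^d$ the sequence $(|A^n x|)$ is $b$-Benford or terminating. Here the terms are as follows. - For real $y\neq 0$, the significand $S_b(y)$ is the unique number in $[1,b)$ with $|y|=S_b(y)\,b^k$ for some $k\in\mathbb{Z}$; also $S_b(0)=0$. A real sequence $(x_n)_{n\ge 1}$ is $b$-Benford if $$\lim_{M\to\infty}\frac{\#\{1\le n\le M: S_b(x_n)\le s\}}{M}=\log_b s\qquad\text{for every } s\in[1,b).$$ - The sequence $(|A^n x|)$ is terminating if $A^n x=0$ for all $n\ge d$. - For $\mathcal{Z}\subset\mathbb{C}\setminus\{0\}$ let $\Delta_{\mathcal{Z}}=\left\{1+\frac{\arg z-\arg w}{2\pi}: z,w\in\mathcal{Z}\right\}$, where $\arg$ takes values in $(-\pi,\pi]$. A set $\mathcal{Z}\subset\mathbb{C}$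 is $b$-nonresonant if for every $r>0$ the set $\mathcal{Z}_r=\{z\in\mathcal{Z}:|z|=r\}$ is either empty or satisfies both $\Delta_{\mathcal{Z}_r}\cap\mathbb{Q}=\{1\}$ and $\log_b r\notin\operatorname{span}_{\mathbb{Q}}\Delta_{\mathcal{Z}_r}$. -/

import Mathlib

open Filter Topology

namespace BenfordLinear

/-- The base-`b` significand: for `x ≠ 0` the number in `[1, b)` with `|x| = S_b(x) * b ^ k` for an
integer `k`, and `S_b(0) = 0`. -/
noncomputable def significand (b : ℕ) (x : ℝ) : ℝ :=
  if x = 0 then 0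
  else (b : ℝ) ^ (Real.logb b |x| - (⌊Real.logb b |x|⌋ : ℝ))

open Classical in
/-- The sequence `x 1, x 2, ...` is `b`-Benford. (The index `0` is irrelevant.) -/
def IsBenford (b : ℕ) (x : ℕ → ℝ) : Prop :=
  ∀ s : ℝ, 1 ≤ s → s < b →
    Tendsto
      (fun M : ℕ => (((Finset.Icc 1 M).filter fun n => significand b (x n) ≤ s).card : ℝ) / (M : ℝ))
      atTop (𝓝 (Real.logb b s))

/-- The set `{1 + (arg z - arg w) / (2 π) : z, w ∈ Z}`, with `arg` taking values in `(-π, π]`. -/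
def argDifferences (Z : Set ℂ) : Set ℝ :=
  {t | ∃ z ∈ Z, ∃ w ∈ Z, t = 1 + (Complex.arg z - Complex.arg w) / (2 * Real.pi)}

/-- `b`-nonresonance of a non-empty subset `Z` of the circle of radius `r` about the origin. -/
def IsNonresonantOnCircle (b : ℕ) (r : ℝ) (Z : Set ℂ) : Prop :=
  Z.Nonempty ∧ (∀ z ∈ Z, ‖z‖ = r) ∧
    argDifferences Z ∩ Set.range ((↑) : ℚ → ℝ) = {1} ∧
    Real.logb b r ∉ Submodule.span ℚ (argDifferences Z)

/-- `b`-nonresonance of an arbitrary set of complex numbers. -/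
def IsNonresonant (b : ℕ) (Z : Set ℂ) : Prop :=
  ∀ r : ℝ, 0 < r →
    IsNonresonantOnCircle b r (Z ∩ {z | ‖z‖ = r}) ∨ Z ∩ {z | ‖z‖ = r} = ∅

/-- The set of all complex eigenvalues of a real square matrix. -/
def complexSpectrum {d : ℕ} (A : Matrix (Fin d) (Fin d) ℝ) : Set ℂ :=
  spectrum ℂ (A.map ((↑) : ℝ → ℂ))

/-- The vector `A ^ n x`, as an element of Euclidean space. -/
noncomputable def orbit {d : ℕ} (A : Matrix (Fin d) (Fin d) ℝ) (x : EuclideanSpace ℝ (Fin d))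
    (n : ℕ) : EuclideanSpace ℝ (Fin d) :=
  Matrix.toEuclideanLin (A ^ n) x

/-- The sequence `|A ^ n x|` is terminating. -/
def IsTerminating {d : ℕ} (A : Matrix (Fin d) (Fin d) ℝ) (x : EuclideanSpace ℝ (Fin d)) : Prop :=
  ∀ n : ℕ, d ≤ n → orbit A x n = 0

end BenfordLinear

namespace BenfordLinear

open Asymptotics

/-! An orbit that vanishes once is terminating, because kernels of powers stabilise by step `d`.
Otherwise, Weyl's criterion (`isBenford_of_hasMeanZero`) asks that `exp (2πi h log_b |A ^ n x|)`
have mean zero for each integer `h ≠ 0`. It suffices to check this along each residue class mod `N`,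
where the sequence is an orbit of `B = A ^ N`, a matrix with nonresonant spectrum.

After complexification, the Jordan form gives `B ^ m v = r ^ m m ^ k (F m + o(1))`, where `F m = ∑
(z / r) ^ m w_z` runs over some eigenvalues of one modulus `r > 0` and all `w_z ≠ 0`
(`exists_leading_asymptotics`). The exponential thus splits into three factors. The one from `m ^ k`
varies slowly and is removed by Abel summation. The one from `r ^ m` is `ζ ^ m` with `ζ = exp (2πi h
log_b r)`. The last is a function of a sequence asymptotic to `P m = ‖F m‖ ^ 2`, a trigonometric
polynomial whose frequencies are ratios of the numbers `z / r`.

The condition on `log_b r` says that `ζ` times a product of such ratios is never `1`. So `ζ ^ m p(P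
m)` has mean zero for each polynomial `p`, being a sum of nontrivial geometric sequences, and
Weierstrass approximation extends this to continuous functions of `P`.

The logarithm is singular at `0`, so `P` must rarely be small. This is
`exists_hasSmallDensity_norm_sum_lt`, which uses the other half of nonresonance: distinct
eigenvalues of equal modulus have no ratio that is a root of unity. -/

/-- The averages of `f` over initial segments tend to zero. -/
def HasMeanZero (f : ℕ → ℂ) : Prop :=
  (fun M : ℕ => ∑ n ∈ Finset.range M, f n) =o[atTop] fun M : ℕ => (M : ℝ)

/-! ### Sequences with mean zero. -/

theorem HasMeanZero.zero : HasMeanZero 0 := by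
  simp [HasMeanZero]

theorem HasMeanZero.add {f g : ℕ → ℂ} (hf : HasMeanZero f) (hg : HasMeanZero g) :
    HasMeanZero (f + g) := by
  unfold HasMeanZero
  simp only [Pi.add_apply, Finset.sum_add_distrib]
  exact IsLittleO.add hf hg

theorem HasMeanZero.const_smul {f : ℕ → ℂ} (c : ℂ) (hf : HasMeanZero f) :
    HasMeanZero (c • f) := by
  unfold HasMeanZero
  simp only [Pi.smul_apply, smul_eq_mul, ← Finset.mul_sum]
  exact IsLittleO.const_mul_left hf c

theorem hasMeanZero_pow {z : ℂ} (hz : ‖z‖ = 1) (hz1 : z ≠ 1) : HasMeanZero fun n => z ^ n := by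
  have h : (fun M : ℕ => ∑ n ∈ Finset.range M, z ^ n) =O[atTop] fun _ : ℕ => (1 : ℝ) := by
    refine IsBigO.of_bound (2 / ‖z - 1‖) (Eventually.of_forall fun M => ?_)
    rw [geom_sum_eq hz1, norm_div, norm_one, mul_one]
    gcongr
    calc ‖z ^ M - 1‖ ≤ ‖z ^ M‖ + ‖(1 : ℂ)‖ := norm_sub_le _ _
      _ = 2 := by rw [norm_pow, hz]; norm_num
  exact h.trans_isLittleO
    ((isLittleO_const_left_of_ne one_ne_zero).2
      (tendsto_norm_atTop_atTop.comp tendsto_natCast_atTop_atTop))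

/-- The error is controlled only on average, so the approximation may fail badly on a set of small
density. This is what permits cutting off the singularity of the logarithm. -/
theorem HasMeanZero.of_approx {f : ℕ → ℂ}
    (h : ∀ ε > 0, ∃ g, HasMeanZero g ∧
      ∀ᶠ M : ℕ in atTop, ∑ n ∈ Finset.range M, ‖f n - g n‖ ≤ ε * M) : HasMeanZero f := by
  refine isLittleO_iff.2 fun ε hε => ?_
  obtain ⟨g, hg, hfg⟩ := h (ε / 2) (by positivity)
  filter_upwards [hfg, isLittleO_iff.1 hg (half_pos hε)] with M h1 h2
  rw [Real.norm_natCast] at h2 ⊢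
  have h3 : ∑ n ∈ Finset.range M, f n =
      ∑ n ∈ Finset.range M, (f n - g n) + ∑ n ∈ Finset.range M, g n := by
    rw [← Finset.sum_add_distrib]; simp
  calc ‖∑ n ∈ Finset.range M, f n‖
      ≤ ‖∑ n ∈ Finset.range M, (f n - g n)‖ + ‖∑ n ∈ Finset.range M, g n‖ := by
        rw [h3]; exact norm_add_le _ _
    _ ≤ ε / 2 * M + ε / 2 * M := add_le_add ((norm_sum_le _ _).trans h1) h2
    _ = ε * M := by ring

theorem isLittleO_sum_range_of_tendsto_zero {u : ℕ → ℂ} (hu : Tendsto u atTop (𝓝 0)) :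
    HasMeanZero u := by
  have h := Asymptotics.IsLittleO.sum_range (f := u) (g := fun _ : ℕ => (1 : ℝ))
    ((isLittleO_one_iff ℝ).2 hu) (fun _ => zero_le_one) (by simpa using tendsto_natCast_atTop_atTop)
  simpa [HasMeanZero] using h

/-- Multiplication by a slowly varying bounded sequence preserves mean zero. -/
theorem HasMeanZero.mul_of_slowly_varying {a b : ℕ → ℂ} {C : ℝ} (ha : HasMeanZero a)
    (hb : ∀ n, ‖b n‖ ≤ 1) (hb' : ∀ n : ℕ, ‖b (n + 1) - b n‖ ≤ C / (n + 1)) :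
    HasMeanZero fun n => b n * a n := by
  have hC : 0 ≤ C := by simpa using (norm_nonneg _).trans (hb' 0)
  set S : ℕ → ℂ := fun M => ∑ n ∈ Finset.range M, a n with hS
  -- The increments of `b` are `O(1 / n)` and `S` is `o(n)`, so their product tends to zero and its
  -- partial sums are `o(M)`.
  have hlim : Tendsto (fun n : ℕ => (b (n + 1) - b n) * S (n + 1)) atTop (𝓝 0) := by
    refine squeeze_zero_norm (a := fun n : ℕ => C * (‖S (n + 1)‖ / ((n + 1 : ℕ) : ℝ)))
      (fun n => ?_) ?_
    · rw [norm_mul]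
      calc _ ≤ C / (n + 1) * ‖S (n + 1)‖ := by gcongr; exact hb' n
        _ = _ := by push_cast; ring
    · have h1 := (ha.norm_left.tendsto_div_nhds_zero).comp (tendsto_add_atTop_nat 1)
      simpa using h1.const_mul C
  have h1 := isLittleO_sum_range_of_tendsto_zero hlim
  have h2 : (fun M : ℕ => b M * S M) =o[atTop] fun M : ℕ => (M : ℝ) := by
    have : b =O[atTop] fun _ => (1 : ℝ) := IsBigO.of_bound 1 (by simpa using ⟨0, fun n _ => hb n⟩)
    simpa using this.mul_isLittleO ha
  -- Abel summation: `∑ b n * a n = b M * S M - ∑ (b (n + 1) - b n) * S (n + 1)`, all over `n < M`.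
  refine (h2.sub h1).congr_left fun M => ?_
  induction M with
  | zero => simp [hS]
  | succ M ih =>
    rw [Finset.sum_range_succ (fun n => b n * a n), ← ih, Finset.sum_range_succ]
    simp only [hS, Finset.sum_range_succ]
    ring

theorem norm_exp_mul_I_sub_exp_mul_I_le (s t : ℝ) :
    ‖Complex.exp (s * Complex.I) - Complex.exp (t * Complex.I)‖ ≤ |s - t| := by
  have h : Complex.exp (s * Complex.I) - Complex.exp (t * Complex.I) =
      Complex.exp (t * Complex.I) * (Complex.exp (Complex.I * ((s - t : ℝ) : ℂ)) - 1) := by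
    rw [mul_sub, ← Complex.exp_add]
    push_cast
    ring_nf
  rw [h, norm_mul, Complex.norm_exp_ofReal_mul_I, one_mul]
  exact Real.norm_exp_I_mul_ofReal_sub_one_le

theorem HasMeanZero.mul_exp_log {a : ℕ → ℂ} (ha : HasMeanZero a) (γ : ℝ) :
    HasMeanZero fun n => Complex.exp ((γ * Real.log n : ℝ) * Complex.I) * a n := by
  refine ha.mul_of_slowly_varying (C := 2 * |γ|)
    (fun n => (Complex.norm_exp_ofReal_mul_I _).le) fun n => ?_
  refine (norm_exp_mul_I_sub_exp_mul_I_le _ _).trans ?_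
  rw [← mul_sub, abs_mul, mul_comm 2, mul_div_assoc]
  refine mul_le_mul_of_nonneg_left ?_ (abs_nonneg γ)
  -- At `n = 0` the left side vanishes since `Real.log 0 = 0 = Real.log 1`. For `n ≥ 1` the
  -- increment is at most `1 / n ≤ 2 / (n + 1)`, whence the constant `2`.
  rcases Nat.eq_zero_or_pos n with rfl | hn
  · simp
  have hn' : (1 : ℝ) ≤ n := by exact_mod_cast hn
  have h0 : (0 : ℝ) < n := by linarith
  push_cast
  rw [abs_of_nonneg (sub_nonneg.2 (Real.log_le_log h0 (by linarith))),
    ← Real.log_div (by positivity) h0.ne']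
  refine (Real.log_le_sub_one_of_pos (by positivity)).trans ?_
  rw [div_sub_one h0.ne', div_le_div_iff₀ h0 (by positivity)]
  linarith

/-- A bounded sequence has mean zero if it has mean zero along every residue class. -/
theorem HasMeanZero.of_residue_classes {f : ℕ → ℂ} {N : ℕ} (hN : 0 < N) (hf : ∀ n, ‖f n‖ ≤ 1)
    (h : ∀ j < N, HasMeanZero fun m => f (N * m + j)) : HasMeanZero f := by
  have hq : Tendsto (fun M : ℕ => M / N) atTop atTop := Nat.tendsto_div_const_atTop hN.ne'
  have h1 : (fun M : ℕ => ∑ j ∈ Finset.range N, ∑ m ∈ Finset.range (M / N), f (N * m + j))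
      =o[atTop] fun M : ℕ => (M : ℝ) := by
    refine IsLittleO.fun_sum fun j hj => ?_
    refine (((h j (Finset.mem_range.1 hj)).comp_tendsto hq)).trans_isBigO ?_
    refine IsBigO.of_bound 1 (Eventually.of_forall fun M => ?_)
    simp only [Function.comp, Real.norm_natCast, one_mul]
    exact_mod_cast Nat.div_le_self M N
  have h2 : (fun M : ℕ => ∑ j ∈ Finset.range (M % N), f (N * (M / N) + j))
      =o[atTop] fun M : ℕ => (M : ℝ) := by
    have : (fun M : ℕ => ∑ j ∈ Finset.range (M % N), f (N * (M / N) + j))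
        =O[atTop] fun _ : ℕ => (1 : ℝ) := by
      refine IsBigO.of_bound N (Eventually.of_forall fun M => ?_)
      calc ‖∑ j ∈ Finset.range (M % N), f (N * (M / N) + j)‖
          ≤ ∑ j ∈ Finset.range (M % N), ‖f (N * (M / N) + j)‖ := norm_sum_le _ _
        _ ≤ ∑ j ∈ Finset.range (M % N), (1 : ℝ) := Finset.sum_le_sum fun j _ => hf _
        _ ≤ N * ‖(1 : ℝ)‖ := by simpa using (Nat.mod_lt M hN).le
    exact this.trans_isLittleO ((isLittleO_const_left_of_ne one_ne_zero).2
      (tendsto_norm_atTop_atTop.comp tendsto_natCast_atTop_atTop))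
  have h3 : ∀ q : ℕ, ∑ m ∈ Finset.range q, ∑ j ∈ Finset.range N, f (N * m + j) =
      ∑ n ∈ Finset.range (N * q), f n := by
    intro q
    induction q with
    | zero => simp
    | succ q ih => rw [Finset.sum_range_succ, ih, Nat.mul_succ, Finset.sum_range_add]
  refine (h1.add h2).congr_left fun M => ?_
  rw [Finset.sum_comm, h3, ← Finset.sum_range_add, Nat.div_add_mod]

/-! ### How often an exponential polynomial is small. -/

/-- The upper density of `E` is at most `δ`, in a strong finitary sense. -/
def HasSmallDensity (E : Set ℕ) (δ : ℝ) : Prop :=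
  ∀ᶠ M : ℕ in atTop, ∑ n ∈ Finset.range M, E.indicator (fun _ => (1 : ℝ)) n ≤ δ * M

theorem HasSmallDensity.mono {E F : Set ℕ} {δ : ℝ} (hF : HasSmallDensity F δ) (h : E ⊆ F) :
    HasSmallDensity E δ := by
  filter_upwards [hF] with M hM
  refine (Finset.sum_le_sum fun n _ => ?_).trans hM
  exact Set.indicator_le_indicator_of_subset h (fun _ => zero_le_one) n

/-- If `E` meets each of its first `K` translates in a set of small density, then `E` itself has
small density. -/
theorem HasSmallDensity.of_translates {E : Set ℕ} {δ : ℝ} {K : ℕ}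
    (hK : 3 ≤ K * δ)
    (h : ∀ k, 0 < k → k < K → HasSmallDensity {n | n ∈ E ∧ n + k ∈ E} (1 / (K : ℝ) ^ 2)) :
    HasSmallDensity E δ := by
  set e : ℕ → ℝ := E.indicator (fun _ => (1 : ℝ)) with he
  have he0 : ∀ n, 0 ≤ e n := fun n => Set.indicator_nonneg (fun _ _ => zero_le_one) n
  have he1 : ∀ n, e n ≤ 1 := fun n => Set.indicator_le_self' (fun _ _ => zero_le_one) n
  have hKpos : (0 : ℝ) < K := by
    by_contra hc
    have : (K : ℝ) = 0 := le_antisymm (not_lt.1 hc) (Nat.cast_nonneg K)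
    rw [this] at hK; norm_num at hK
  have hev : ∀ᶠ M : ℕ in atTop, ∀ k ∈ Finset.Ioo 0 K,
      ∑ n ∈ Finset.range M, e n * e (n + k) ≤ 1 / (K : ℝ) ^ 2 * M := by
    refine (Finset.eventually_all _).2 fun k hk => ?_
    rw [Finset.mem_Ioo] at hk
    filter_upwards [h k hk.1 hk.2] with M hM
    refine le_trans (Finset.sum_le_sum fun n _ => ?_) hM
    by_cases h1 : n ∈ E <;> by_cases h2 : n + k ∈ E <;> simp [he, h1, h2]
  -- A window containing `c` points of `E` satisfies `c ≤ 1 + c(c - 1) / 2`, the last term counting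
  -- pairs.
  have hpt : ∀ (n L : ℕ), ∑ i ∈ Finset.range L, e (n + i) ≤
      1 + ∑ j ∈ Finset.range L, ∑ i ∈ Finset.range j, e (n + i) * e (n + j) := by
    intro n L
    induction L with
    | zero => simp
    | succ L ih =>
      rw [Finset.sum_range_succ, Finset.sum_range_succ _ L, ← Finset.sum_mul]
      have hP : 0 ≤ ∑ j ∈ Finset.range L, ∑ i ∈ Finset.range j, e (n + i) * e (n + j) :=
        Finset.sum_nonneg fun j _ => Finset.sum_nonneg fun i _ => mul_nonneg (he0 _) (he0 _)
      by_cases h1 : n + L ∈ E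
      · have : e (n + L) = 1 := by simp [he, h1]
        rw [this]; linarith
      · have : e (n + L) = 0 := by simp [he, h1]
        rw [this]; linarith
  have hshift : ∀ (g : ℕ → ℝ), (∀ n, 0 ≤ g n) → (∀ n, g n ≤ 1) → ∀ i M : ℕ,
      ∑ n ∈ Finset.range M, g (n + i) ≤ ∑ n ∈ Finset.range M, g n + i ∧
      ∑ n ∈ Finset.range M, g n ≤ ∑ n ∈ Finset.range M, g (n + i) + i := by
    intro g g0 g1 i M
    have h1 : ∑ n ∈ Finset.range i, g n + ∑ n ∈ Finset.range M, g (n + i) =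
        ∑ n ∈ Finset.range M, g n + ∑ n ∈ Finset.range i, g (M + n) := by
      rw [← Finset.sum_range_add, add_comm M i, Finset.sum_range_add]
      simp only [add_comm]
    have hb : ∀ g' : ℕ → ℝ, (∀ n, g' n ≤ 1) → ∑ n ∈ Finset.range i, g' n ≤ i := fun g' h' => by
      simpa using Finset.sum_le_sum (s := Finset.range i) fun n _ => h' n
    have h2 := hb g g1
    have h3 := hb (fun n => g (M + n)) fun n => g1 _
    have h4 : 0 ≤ ∑ n ∈ Finset.range i, g n := Finset.sum_nonneg fun n _ => g0 n
    have h5 : 0 ≤ ∑ n ∈ Finset.range i, g (M + n) := Finset.sum_nonneg fun n _ => g0 _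
    constructor <;> linarith
  -- Averaging the windows gives `K * ∑ e ≤ 2M + K ^ 3 + K ^ 2`. The threshold on `M` makes this at
  -- most `3M ≤ K * δ * M`.
  filter_upwards [hev, tendsto_natCast_atTop_atTop.eventually_ge_atTop ((K : ℝ) ^ 3 + K ^ 2)]
    with M hM hMK
  have hpair : ∀ j ∈ Finset.range K, ∀ i ∈ Finset.range j,
      ∑ n ∈ Finset.range M, e (n + i) * e (n + j) ≤ 1 / (K : ℝ) ^ 2 * M + K := by
    intro j hj i hi
    rw [Finset.mem_range] at hi hj
    have h1 := hM (j - i) (by rw [Finset.mem_Ioo]; omega)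
    have h2 := (hshift (fun n => e n * e (n + (j - i))) (fun n => mul_nonneg (he0 _) (he0 _))
      (fun n => mul_le_one₀ (he1 _) (he0 _) (he1 _)) i M).1
    have h3 : ∀ n, n + i + (j - i) = n + j := fun n => by omega
    simp only [h3] at h2
    have h4 : (i : ℝ) ≤ K := by exact_mod_cast (hi.trans hj).le
    linarith
  have hlow : K * ∑ n ∈ Finset.range M, e n - K * K ≤
      ∑ n ∈ Finset.range M, ∑ i ∈ Finset.range K, e (n + i) := by
    rw [Finset.sum_comm]
    have : ∑ i ∈ Finset.range K, (∑ n ∈ Finset.range M, e n - K) ≤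
        ∑ i ∈ Finset.range K, ∑ n ∈ Finset.range M, e (n + i) := by
      refine Finset.sum_le_sum fun i hi => ?_
      have h1 := (hshift e he0 he1 i M).2
      have h4 : (i : ℝ) ≤ K := by exact_mod_cast (Finset.mem_range.1 hi).le
      linarith
    rw [Finset.sum_const, Finset.card_range, nsmul_eq_mul, mul_sub] at this
    exact this
  have hup : ∑ n ∈ Finset.range M, ∑ i ∈ Finset.range K, e (n + i) ≤
      M + K * (K * (1 / (K : ℝ) ^ 2 * M + K)) := by
    calc _ ≤ ∑ n ∈ Finset.range M,
          (1 + ∑ j ∈ Finset.range K, ∑ i ∈ Finset.range j, e (n + i) * e (n + j)) :=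
          Finset.sum_le_sum fun n _ => hpt n K
      _ = M + ∑ j ∈ Finset.range K, ∑ i ∈ Finset.range j,
          ∑ n ∈ Finset.range M, e (n + i) * e (n + j) := by
        rw [Finset.sum_add_distrib, Finset.sum_comm]
        simp [Finset.sum_comm (s := Finset.range M)]
      _ ≤ M + ∑ j ∈ Finset.range K, K * (1 / (K : ℝ) ^ 2 * M + K) := by
        gcongr with j hj
        refine (Finset.sum_le_sum (hpair j hj)).trans ?_
        rw [Finset.sum_const, Finset.card_range, nsmul_eq_mul]
        gcongr
        exact (Finset.mem_range.1 hj).le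
      _ = _ := by rw [Finset.sum_const, Finset.card_range, nsmul_eq_mul]
  have hid : (K : ℝ) * (K * (1 / (K : ℝ) ^ 2 * M + K)) = M + K ^ 3 := by
    field_simp
  have hfin : K * ∑ n ∈ Finset.range M, e n ≤ K * (δ * M) := by
    have : 3 * (M : ℝ) ≤ K * δ * M := by gcongr
    nlinarith
  exact le_of_mul_le_mul_left hfin hKpos

/-- An exponential polynomial whose frequencies have modulus one, with no ratio of two of them a
nontrivial root of unity, is rarely close to zero. -/
theorem exists_hasSmallDensity_norm_sum_lt {V : Type*} [NormedAddCommGroup V] [NormedSpace ℂ V]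
    (s : Finset ℂ) (hs : s.Nonempty) (hs1 : ∀ u ∈ s, ‖u‖ = 1)
    (hroot : ∀ u ∈ s, ∀ v ∈ s, ∀ k : ℕ, 0 < k → u ^ k = v ^ k → u = v)
    (w : ℂ → V) (hw : ∀ u ∈ s, w u ≠ 0) {δ : ℝ} (hδ : 0 < δ) :
    ∃ ε > 0, HasSmallDensity {n | ‖∑ u ∈ s, u ^ n • w u‖ < ε} δ := by
  classical
  induction hs using Finset.Nonempty.cons_induction generalizing w δ with
  | singleton a =>
    refine ⟨‖w a‖, norm_pos_iff.2 (hw a (by simp)), ?_⟩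
    have : {n : ℕ | ‖∑ u ∈ {a}, u ^ n • w u‖ < ‖w a‖} = ∅ := by
      ext n
      simp [norm_smul, hs1 a (by simp)]
    rw [this]
    refine Eventually.of_forall fun M => ?_
    simp only [Set.indicator_empty, Finset.sum_const_zero]
    positivity
  | cons a t ha ht ih =>
    -- With `F` the full sum, `F (n + k) - a ^ k • F n` has no frequency `a`, and its other
    -- coefficients are multiplied by `u ^ k - a ^ k ≠ 0`. By induction it is rarely small, so `F`
    -- is rarely small at both `n` and `n + k`; `of_translates` then applies.
    obtain ⟨K, hK⟩ := exists_nat_gt (3 / δ)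
    have hKpos : (0 : ℝ) < K := lt_trans (by positivity) hK
    have key : ∀ k ∈ Finset.Ioo 0 K, ∃ ε > 0,
        HasSmallDensity {n | ‖∑ u ∈ t, u ^ n • ((u ^ k - a ^ k) • w u)‖ < ε} (1 / (K : ℝ) ^ 2) := by
      intro k hk
      refine ih (fun u hu => hs1 u (Finset.mem_cons_of_mem hu))
        (fun u hu v hv => hroot u (Finset.mem_cons_of_mem hu) v (Finset.mem_cons_of_mem hv))
        (fun u => (u ^ k - a ^ k) • w u) (fun u hu => ?_) (by positivity)
      refine smul_ne_zero (fun h0 => ha ?_) (hw u (Finset.mem_cons_of_mem hu))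
      rwa [← hroot u (Finset.mem_cons_of_mem hu) a (Finset.mem_cons_self a t) k
        (Finset.mem_Ioo.1 hk).1 (sub_eq_zero.1 h0)]
    choose! η hη hηd using key
    have hex : ∀ᶠ ε : ℝ in 𝓝[>] 0, ∀ k ∈ Finset.Ioo 0 K, ε < η k / 2 :=
      (Finset.eventually_all _).2 fun k hk =>
        (eventually_lt_nhds (half_pos (hη k hk))).filter_mono nhdsWithin_le_nhds
    obtain ⟨ε, hε, hεpos⟩ := (hex.and self_mem_nhdsWithin).exists
    refine ⟨ε, hεpos, HasSmallDensity.of_translates (K := K) ?_ fun k hk0 hkK => ?_⟩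
    · rw [div_lt_iff₀ hδ] at hK; exact hK.le
    have hk : k ∈ Finset.Ioo 0 K := Finset.mem_Ioo.2 ⟨hk0, hkK⟩
    refine (hηd k hk).mono fun n hn => ?_
    obtain ⟨h1, h2⟩ := hn
    simp only [Set.mem_ofPred_eq] at h1 h2 ⊢
    have hid : ∑ u ∈ t, u ^ n • ((u ^ k - a ^ k) • w u) =
        ∑ u ∈ Finset.cons a t ha, u ^ (n + k) • w u -
          a ^ k • ∑ u ∈ Finset.cons a t ha, u ^ n • w u := by
      rw [Finset.smul_sum, ← Finset.sum_sub_distrib, Finset.sum_cons]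
      rw [smul_smul, ← pow_add, add_comm k n, sub_self, zero_add]
      refine Finset.sum_congr rfl fun u _ => ?_
      rw [smul_smul, smul_smul, ← sub_smul]
      ring_nf
    rw [hid]
    calc _ ≤ ‖∑ u ∈ Finset.cons a t ha, u ^ (n + k) • w u‖ +
          ‖a ^ k • ∑ u ∈ Finset.cons a t ha, u ^ n • w u‖ := norm_sub_le _ _
      _ < ε + ε := by
        rw [norm_smul, norm_pow, hs1 a (Finset.mem_cons_self a t), one_pow, one_mul]
        exact add_lt_add h2 h1
      _ ≤ η k := by linarith [hε k hk]

/-! ### Weyl's criterion and the Benford property. -/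

open MeasureTheory

instance : IsProbabilityMeasure (volume : Measure UnitAddCircle) :=
  ⟨UnitAddCircle.measure_univ⟩

/-- The uniform probability measure on `t 0, ..., t M`, as points of the circle. -/
noncomputable def empiricalMeasure (t : ℕ → ℝ) (M : ℕ) : Measure UnitAddCircle :=
  ((M + 1 : ℕ) : ENNReal)⁻¹ • ∑ n ∈ Finset.range (M + 1), Measure.dirac (t n : UnitAddCircle)

instance (t : ℕ → ℝ) (M : ℕ) : IsProbabilityMeasure (empiricalMeasure t M) := by
  constructor
  simp only [empiricalMeasure, Measure.smul_apply, Measure.finsetSum_apply, measure_univ,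
    Finset.sum_const, Finset.card_range, nsmul_eq_mul, mul_one, smul_eq_mul]
  exact ENNReal.inv_mul_cancel (by simp) (by simp)

theorem integral_empiricalMeasure {E : Type*} [NormedAddCommGroup E] [NormedSpace ℝ E]
    [CompleteSpace E] (t : ℕ → ℝ) (M : ℕ) (f : C(UnitAddCircle, E)) :
    ∫ x, f x ∂empiricalMeasure t M =
      ((M + 1 : ℕ) : ℝ)⁻¹ • ∑ n ∈ Finset.range (M + 1), f (t n) := by
  rw [empiricalMeasure, integral_smul_measure, integral_finsetSum_measure,
    ENNReal.toReal_inv, ENNReal.toReal_natCast]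
  · simp [integral_dirac]
  · intro i _
    exact integrable_dirac (by simp)

/-- Translation by `1 / (2h)` preserves the measure and changes the sign of the character. -/
theorem integral_fourier_of_ne_zero {h : ℤ} (hh : h ≠ 0) :
    ∫ x : UnitAddCircle, (fourier h x : ℂ) = 0 := by
  have h1 := integral_add_right_eq_self (μ := (volume : Measure UnitAddCircle))
    (fun x => (fourier h x : ℂ)) (((1 / 2 / h : ℝ)) : UnitAddCircle)
  simp_rw [fourier_add_half_inv_index hh one_pos, integral_neg] at h1
  exact self_eq_neg.1 h1.symm

/-- **Weyl's criterion**: weak convergence of the empirical measures to the uniform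
distribution on the circle. -/
theorem tendsto_integral_empiricalMeasure {t : ℕ → ℝ}
    (ht : ∀ h : ℤ, h ≠ 0 →
      HasMeanZero fun n => Complex.exp (2 * Real.pi * Complex.I * h * t n))
    (f : C(UnitAddCircle, ℂ)) :
    Tendsto (fun M => ∫ x, f x ∂empiricalMeasure t M) atTop (𝓝 (∫ x, f x)) := by
  have hint : ∀ (μ : Measure UnitAddCircle) [IsProbabilityMeasure μ] (g : C(UnitAddCircle, ℂ)),
      Integrable g μ := fun μ _ g => g.continuous.integrable_of_hasCompactSupport
        (HasCompactSupport.of_compactSpace _)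
  -- The functions for which convergence holds form a subspace. It is closed because integration
  -- against a probability measure is 1-Lipschitz in the sup norm, and it contains the characters,
  -- whose span is dense.
  let S : Submodule ℂ C(UnitAddCircle, ℂ) :=
    { carrier := {f | Tendsto (fun M => ∫ x, f x ∂empiricalMeasure t M) atTop (𝓝 (∫ x, f x))}
      zero_mem' := by simp
      add_mem' := fun {f g} hf hg => by
        simp only [Set.mem_ofPred_eq, ContinuousMap.add_apply] at *
        rw [integral_add (hint _ f) (hint _ g)]
        simp_rw [fun M => integral_add (hint (empiricalMeasure t M) f) (hint _ g)]
        exact hf.add hg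
      smul_mem' := fun c f hf => by
        simp only [Set.mem_ofPred_eq, ContinuousMap.smul_apply, integral_smul] at *
        exact hf.const_smul c }
  have hclosed : IsClosed (S : Set C(UnitAddCircle, ℂ)) := by
    have hdist : ∀ (μ : Measure UnitAddCircle) [IsProbabilityMeasure μ]
        (f g : C(UnitAddCircle, ℂ)), dist (∫ x, f x ∂μ) (∫ x, g x ∂μ) ≤ dist f g := by
      intro μ _ f g
      rw [dist_eq_norm, ← integral_sub (hint μ f) (hint μ g)]
      refine (norm_integral_le_of_norm_le_const (C := dist f g)
        (Eventually.of_forall fun x => ?_)).trans (by simp)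
      rw [← dist_eq_norm]
      exact ContinuousMap.dist_apply_le_dist x
    refine isClosed_of_closure_subset fun f hf => ?_
    refine Metric.tendsto_atTop'.2 fun ε hε => ?_
    obtain ⟨g, hg, hfg⟩ := Metric.mem_closure_iff.1 hf (ε / 3) (by positivity)
    obtain ⟨N, hN⟩ := Metric.tendsto_atTop'.1 hg (ε / 3) (by positivity)
    refine ⟨N, fun n hn => ?_⟩
    have h1 := hdist (empiricalMeasure t n) f g
    have h2 := hdist volume g f
    rw [dist_comm g f] at h2
    have h3 := dist_triangle4 (∫ x, f x ∂empiricalMeasure t n) (∫ x, g x ∂empiricalMeasure t n)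
      (∫ x, g x) (∫ x, f x)
    linarith [hN n hn]
  have hfour : Submodule.span ℂ (Set.range (fourier (T := 1))) ≤ S := by
    rw [Submodule.span_le]
    rintro _ ⟨h, rfl⟩
    change Tendsto _ _ _
    rcases eq_or_ne h 0 with rfl | hh
    · simp
    rw [integral_fourier_of_ne_zero hh]
    have h1 := ((ht h hh).norm_left.tendsto_div_nhds_zero).comp (tendsto_add_atTop_nat 1)
    refine squeeze_zero_norm (fun M => le_of_eq ?_) h1
    rw [integral_empiricalMeasure, norm_smul]
    simp only [fourier_coe_apply, Function.comp, Complex.ofReal_one, div_one, norm_inv,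
      Real.norm_natCast]
    rw [div_eq_inv_mul]
  have := Submodule.topologicalClosure_minimal _ hfour hclosed
  rw [span_fourier_closure_eq_top] at this
  exact this (Submodule.mem_top (x := f))

theorem coe_fract (x : ℝ) : ((Int.fract x : ℝ) : UnitAddCircle) = x := by
  rw [Int.fract, AddCircle.coe_sub, sub_eq_self, AddCircle.coe_eq_zero_iff]
  exact ⟨⌊x⌋, by simp⟩

theorem coe_mem_image_Icc_iff {c : ℝ} (hc1 : c < 1) (x : ℝ) :
    (x : UnitAddCircle) ∈ ((↑) : ℝ → UnitAddCircle) '' Set.Icc 0 c ↔ Int.fract x ≤ c := by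
  constructor
  · rintro ⟨y, hy, hxy⟩
    rw [← coe_fract x, AddCircle.coe_eq_coe_iff_of_mem_Ico (a := 0)] at hxy
    · exact hxy ▸ hy.2
    · exact ⟨hy.1, by linarith [hy.2]⟩
    · exact ⟨Int.fract_nonneg x, by linarith [Int.fract_lt_one x]⟩
  · intro h
    exact ⟨Int.fract x, ⟨Int.fract_nonneg x, h⟩, coe_fract x⟩

theorem isClosed_image_Icc (c : ℝ) :
    IsClosed (((↑) : ℝ → UnitAddCircle) '' Set.Icc 0 c) :=
  (isCompact_Icc.image (AddCircle.continuous_mk' 1)).isClosed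

theorem volume_image_Icc {c : ℝ} (hc0 : 0 ≤ c) (hc1 : c < 1) :
    volume (((↑) : ℝ → UnitAddCircle) '' Set.Icc 0 c) = ENNReal.ofReal c := by
  rw [AddCircle.add_projection_respects_measure 1 0 (isClosed_image_Icc c).measurableSet]
  -- The fundamental domain is `Ioc 0 1`, so the endpoint `0` of the arc reappears as the null set
  -- `{1}`.
  have h : (QuotientAddGroup.mk ⁻¹' (((↑) : ℝ → UnitAddCircle) '' Set.Icc 0 c) ∩
      Set.Ioc 0 (0 + 1) : Set ℝ) = Set.Ioc 0 c ∪ {1} := by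
    ext x
    simp only [Set.mem_inter_iff, Set.mem_preimage, Set.mem_union, Set.mem_singleton_iff,
      Set.mem_Ioc, zero_add]
    rw [coe_mem_image_Icc_iff hc1]
    constructor
    · rintro ⟨h1, h2, h3⟩
      rcases h3.lt_or_eq with h3 | h3
      · rw [Int.fract_eq_self.2 ⟨h2.le, h3⟩] at h1
        exact Or.inl ⟨h2, h1⟩
      · exact Or.inr h3
    · rintro (⟨h1, h2⟩ | rfl)
      · rw [Int.fract_eq_self.2 ⟨h1.le, by linarith⟩]
        exact ⟨h2, h1, by linarith⟩
      · simpa using hc0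
  rw [h, measure_union (by simp [hc1]) (measurableSet_singleton _)]
  simp

theorem volume_frontier_image_Icc (c : ℝ) :
    volume (frontier (((↑) : ℝ → UnitAddCircle) '' Set.Icc 0 c)) = 0 := by
  have h : frontier (((↑) : ℝ → UnitAddCircle) '' Set.Icc 0 c) ⊆
      {((0 : ℝ) : UnitAddCircle)} ∪ {(c : UnitAddCircle)} := by
    rw [(isClosed_image_Icc c).frontier_eq]
    rintro _ ⟨⟨y, hy, rfl⟩, hy'⟩
    by_contra hne
    simp only [Set.mem_union, Set.mem_singleton_iff, not_or] at hne
    refine hy' (interior_maximal (Set.image_mono Set.Ioo_subset_Icc_self)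
      (QuotientAddGroup.isOpenMap_coe _ isOpen_Ioo) ⟨y, ⟨?_, ?_⟩, rfl⟩)
    · exact lt_of_le_of_ne hy.1 fun h0 => hne.1 (by rw [h0])
    · exact lt_of_le_of_ne hy.2 fun h0 => hne.2 (by rw [h0])
  refine measure_mono_null h (measure_union_null ?_ ?_) <;>
  · rw [← Metric.closedBall_zero, AddCircle.volume_closedBall]
    simp

/-- The portmanteau theorem: the arc from `0` to `c` has null frontier, so weak convergence gives
convergence of its measure. -/
theorem tendsto_card_fract_le {t : ℕ → ℝ}
    (ht : ∀ h : ℤ, h ≠ 0 →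
      HasMeanZero fun n => Complex.exp (2 * Real.pi * Complex.I * h * t n))
    {c : ℝ} (hc0 : 0 ≤ c) (hc1 : c < 1) :
    Tendsto (fun M : ℕ => (((Finset.range M).filter fun n => Int.fract (t n) ≤ c).card : ℝ) / M)
      atTop (𝓝 c) := by
  let μ : ℕ → ProbabilityMeasure UnitAddCircle := fun M => ⟨empiricalMeasure t M, inferInstance⟩
  let ν : ProbabilityMeasure UnitAddCircle := ⟨volume, inferInstance⟩
  have hμ : Tendsto μ atTop (𝓝 ν) := by
    refine ProbabilityMeasure.tendsto_iff_forall_integral_tendsto.2 fun f => ?_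
    have h1 := tendsto_integral_empiricalMeasure ht
      ⟨fun x => ((f x : ℝ) : ℂ), Complex.continuous_ofReal.comp f.continuous⟩
    simp only [ContinuousMap.coe_mk, integral_complex_ofReal] at h1
    exact (Complex.continuous_re.tendsto _).comp h1
  have h1 := ProbabilityMeasure.tendsto_measure_of_null_frontier_of_tendsto' hμ
    (volume_frontier_image_Icc c)
  have h2 := (ENNReal.tendsto_toReal (by simp)).comp h1
  rw [show ((ν : Measure UnitAddCircle) (((↑) : ℝ → UnitAddCircle) '' Set.Icc 0 c)).toReal = c by
    rw [show (ν : Measure UnitAddCircle) = volume from rfl, volume_image_Icc hc0 hc1,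
      ENNReal.toReal_ofReal hc0]] at h2
  rw [← tendsto_add_atTop_iff_nat 1]
  refine h2.congr fun M => ?_
  have hmeas : MeasurableSet (((↑) : ℝ → UnitAddCircle) '' Set.Icc 0 c) :=
    (isClosed_image_Icc c).measurableSet
  simp only [Function.comp, μ, ProbabilityMeasure.coe_mk, empiricalMeasure, Measure.smul_apply,
    Measure.finsetSum_apply, Measure.dirac_apply' _ hmeas, smul_eq_mul, ENNReal.toReal_mul]
  rw [ENNReal.toReal_sum (fun n _ => by
    by_cases hn : (t n : UnitAddCircle) ∈ ((↑) : ℝ → UnitAddCircle) '' Set.Icc 0 c <;> simp [hn])]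
  rw [Finset.card_filter, Nat.cast_sum, div_eq_inv_mul]
  congr 1
  · rw [ENNReal.toReal_inv, ENNReal.toReal_natCast]
  · refine Finset.sum_congr rfl fun n _ => ?_
    by_cases hn : Int.fract (t n) ≤ c
    · simp [hn, (coe_mem_image_Icc_iff hc1 (t n)).2 hn]
    · simp [hn, mt (coe_mem_image_Icc_iff hc1 (t n)).1 hn]

/-- The base-`b` logarithm of the significand is the fractional part of `log_b |x n|`. The index
shift reconciles counting from `1` with sums over `Finset.range`. -/
theorem isBenford_of_hasMeanZero {b : ℕ} (hb : 2 ≤ b) {x : ℕ → ℝ} (hx : ∀ n, x n ≠ 0)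
    (h : ∀ h : ℤ, h ≠ 0 → HasMeanZero fun n =>
      Complex.exp (2 * Real.pi * Complex.I * h * Real.logb b |x (n + 1)|)) :
    IsBenford b x := by
  intro s hs1 hsb
  have hb1 : (1 : ℝ) < b := by exact_mod_cast hb
  have h1 := tendsto_card_fract_le h (c := Real.logb b s) (Real.logb_nonneg hb1 hs1)
    ((Real.logb_lt_iff_lt_rpow hb1 (by linarith)).2 (by simpa using hsb))
  have hiff : ∀ n, significand b (x n) ≤ s ↔ Int.fract (Real.logb b |x n|) ≤ Real.logb b s := by
    intro n
    rw [significand, if_neg (hx n), Int.self_sub_floor,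
      Real.le_logb_iff_rpow_le hb1 (by linarith)]
  refine h1.congr fun M => ?_
  congr 2
  refine Finset.card_bij (fun n _ => n + 1) ?_ (by simp) ?_
  · intro n hn
    simp only [Finset.mem_filter, Finset.mem_range, Finset.mem_Icc, hiff] at hn ⊢
    exact ⟨by omega, hn.2⟩
  · intro n hn
    simp only [Finset.mem_filter, Finset.mem_range, Finset.mem_Icc, hiff] at hn ⊢
    obtain ⟨k, rfl⟩ : ∃ k, n = k + 1 := ⟨n - 1, by omega⟩
    exact ⟨k, ⟨by omega, hn.2⟩, rfl⟩

/-! ### Asymptotics of orbits of a linear map. -/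

/-- Powers of a linear map, applied to a vector, are eventually an exponential polynomial whose
frequencies are the nonzero eigenvalues. -/
theorem exists_pow_apply_eq_sum {V : Type*} [AddCommGroup V] [Module ℂ V] [FiniteDimensional ℂ V]
    (f : Module.End ℂ V) (v : V) :
    ∃ c : ℂ × ℕ →₀ V, (∀ p ∈ c.support, p.1 ≠ 0 ∧ p.1 ∈ spectrum ℂ f) ∧
      ∀ᶠ m : ℕ in atTop,
        (f ^ m) v = c.sum fun p w => ((m.choose p.2 : ℂ) * p.1 ^ m) • w := by
  classical
  have hv : v ∈ ⨆ μ : ℂ, f.maxGenEigenspace μ := by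
    rw [Module.End.iSup_maxGenEigenspace_eq_top]; trivial
  induction hv using Submodule.iSup_induction' with
  | zero => exact ⟨0, by simp, by simp⟩
  | add x y _ _ hx hy =>
    obtain ⟨c, hc, hc'⟩ := hx
    obtain ⟨e, he, he'⟩ := hy
    refine ⟨c + e, fun p hp => ?_, ?_⟩
    · rcases Finset.mem_union.1 (Finsupp.support_add hp) with h | h
      exacts [hc p h, he p h]
    · filter_upwards [hc', he'] with m h1 h2
      rw [map_add, h1, h2, Finsupp.sum_add_index']
      · simp
      · simp
  | mem μ x hx =>
    obtain ⟨k, hk⟩ := (Module.End.mem_maxGenEigenspace f μ x).1 hx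
    rcases eq_or_ne x 0 with rfl | hx0
    · exact ⟨0, by simp, by simp⟩
    have hkill : ∀ j, k ≤ j → ((f - μ • 1) ^ j) x = 0 := by
      intro j hj
      rw [← Nat.sub_add_cancel hj, pow_add, Module.End.mul_apply, hk, map_zero]
    -- The generalized eigenspace of `0` is killed by high powers, hence contributes nothing for
    -- large `m`.
    rcases eq_or_ne μ 0 with rfl | hμ
    · refine ⟨0, by simp, ?_⟩
      filter_upwards [eventually_ge_atTop k] with m hm
      simpa using hkill m hm
    have hspec : μ ∈ spectrum ℂ f := by
      rw [← Module.End.hasEigenvalue_iff_mem_spectrum]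
      have : f.HasUnifEigenvalue μ ⊤ := fun h => hx0 (by
        rw [Module.End.maxGenEigenspace, h] at hx
        exact (Submodule.mem_bot ℂ).1 hx)
      exact this.lt one_pos
    -- Binomial expansion of `((f - μ) + μ) ^ m`, cut at `j < k` by nilpotency; the factor `μ⁻¹ ^ j`
    -- comes from `μ ^ (m - j)`.
    refine ⟨∑ j ∈ Finset.range k, Finsupp.single (μ, j) ((μ⁻¹) ^ j • ((f - μ • 1) ^ j) x),
      fun p hp => ?_, ?_⟩
    · obtain ⟨j, -, hj⟩ := Finset.mem_biUnion.1 (Finsupp.support_finsetSum hp)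
      rw [Finset.mem_singleton.1 (Finsupp.support_single_subset hj)]
      exact ⟨hμ, hspec⟩
    · filter_upwards [eventually_ge_atTop k] with m hm
      rw [← Finsupp.sum_finsetSum_index (by simp) (by simp)]
      have hcomm : Commute (f - μ • 1) (μ • (1 : Module.End ℂ V)) :=
        (Commute.one_right _).smul_right μ
      have h1 : f ^ m = ((f - μ • 1) + μ • 1) ^ m := by rw [sub_add_cancel]
      rw [h1, hcomm.add_pow, LinearMap.sum_apply]
      symm
      refine Finset.sum_subset_zero_on_sdiff (Finset.range_subset_range.2 (by omega)) ?_ ?_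
      · intro j hj
        simp only [Finset.mem_sdiff, Finset.mem_range, not_lt] at hj
        have h2 : (f - μ • 1) ^ j * (μ • 1) ^ (m - j) * (m.choose j : Module.End ℂ V) =
            ((μ • 1) ^ (m - j) * (m.choose j : Module.End ℂ V)) * (f - μ • 1) ^ j := by
          rw [mul_assoc]
          exact ((hcomm.pow_pow j (m - j)).mul_right (Nat.cast_commute _ _).symm).eq
        rw [h2, Module.End.mul_apply, hkill j hj.2, map_zero]
      · intro j hj
        have hjm : j ≤ m := (Finset.mem_range.1 hj).le.trans hm
        rw [Finsupp.sum_single_index (by simp), smul_pow, one_pow]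
        simp only [Module.End.mul_apply, Module.End.natCast_apply, LinearMap.smul_apply,
          Module.End.one_apply, map_nsmul, map_smul]
        rw [← Nat.cast_smul_eq_nsmul ℂ, smul_smul, smul_smul]
        congr 1
        rw [pow_sub₀ _ hμ hjm, inv_pow]
        ring

theorem tendsto_choose_div_pow (k : ℕ) :
    Tendsto (fun m : ℕ => (m.choose k : ℝ) / (m : ℝ) ^ k) atTop (𝓝 ((k.factorial : ℝ)⁻¹)) := by
  have h1 := (isEquivalent_choose k).div
    (Asymptotics.IsEquivalent.refl (u := fun m : ℕ => (m : ℝ) ^ k))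
  refine h1.tendsto_nhds_iff.2 (tendsto_const_nhds.congr' ?_)
  filter_upwards [eventually_gt_atTop 0] with m hm
  have : (m : ℝ) ^ k ≠ 0 := by positivity
  simp only [Pi.div_apply]
  field_simp

theorem tendsto_choose_div_pow_of_lt {j k : ℕ} (h : j < k) :
    Tendsto (fun m : ℕ => (m.choose j : ℝ) / (m : ℝ) ^ k) atTop (𝓝 0) := by
  obtain ⟨i, rfl⟩ := Nat.exists_eq_add_of_lt h
  have h1 := (tendsto_choose_div_pow j).mul
    ((tendsto_pow_atTop (n := i + 1) (by omega)).comp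
      (tendsto_natCast_atTop_atTop (R := ℝ))).inv_tendsto_atTop
  rw [mul_zero] at h1
  refine h1.congr fun m => ?_
  simp only [Pi.inv_apply, Function.comp]
  rw [add_assoc, pow_add _ j, ← div_eq_mul_inv, div_div]

theorem tendsto_pow_mul_choose_div_pow {ρ : ℝ} (h0 : 0 ≤ ρ) (h1 : ρ < 1) (j k : ℕ) :
    Tendsto (fun m : ℕ => ρ ^ m * ((m.choose j : ℝ) / (m : ℝ) ^ k)) atTop (𝓝 0) := by
  refine squeeze_zero (fun m => by positivity) (fun m => ?_)
    (tendsto_pow_const_mul_const_pow_of_lt_one j h0 h1)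
  rw [mul_comm]
  gcongr
  rcases Nat.eq_zero_or_pos m with rfl | hm
  · rcases Nat.eq_zero_or_pos j with rfl | hj <;> rcases Nat.eq_zero_or_pos k with rfl | hk
    · simp
    · simp [hk.ne']
    · simp [hj.ne', Nat.choose_eq_zero_of_lt hj]
    · simp [hj.ne', Nat.choose_eq_zero_of_lt hj]
  · refine (div_le_self (by positivity) (one_le_pow₀ (by exact_mod_cast hm))).trans ?_
    exact_mod_cast Nat.choose_le_pow m j

/-- The dominant part of an orbit of a linear map. -/
theorem exists_leading_asymptotics {V : Type*} [NormedAddCommGroup V] [NormedSpace ℂ V]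
    [FiniteDimensional ℂ V] (f : Module.End ℂ V) (v : V) (hv : ∀ m : ℕ, (f ^ m) v ≠ 0) :
    ∃ r : ℝ, 0 < r ∧ ∃ (k : ℕ) (T : Finset ℂ) (w : ℂ → V), T.Nonempty ∧
      (∀ z ∈ T, z ∈ spectrum ℂ f ∧ ‖z‖ = r) ∧ (∀ z ∈ T, w z ≠ 0) ∧
      Tendsto (fun m : ℕ => ((r : ℂ) ^ m * (m : ℂ) ^ k)⁻¹ • (f ^ m) v -
        ∑ z ∈ T, (z / r) ^ m • w z) atTop (𝓝 0) := by
  classical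
  obtain ⟨c, hc, hcv⟩ := exists_pow_apply_eq_sum f v
  have hne : c.support.Nonempty := by
    rw [Finsupp.support_nonempty_iff]
    rintro rfl
    obtain ⟨m, hm⟩ := hcv.exists
    exact hv m (by simpa using hm)
  -- Growth of `m.choose j * z ^ m` is ordered lexicographically by `(‖z‖, j)`. Terms attaining the
  -- maximum `(r, k)` keep amplitude `1 / k!` after normalisation; all others decay.
  obtain ⟨p, hp, hmax⟩ := Finset.exists_max_image c.support
    (fun p => toLex (‖p.1‖, p.2)) hne
  obtain ⟨z₀, k⟩ := p
  have hr : 0 < ‖z₀‖ := norm_pos_iff.2 (hc _ hp).1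
  set r := ‖z₀‖ with hrdef
  set main := c.support.filter fun p => ‖p.1‖ = r ∧ p.2 = k with hmain
  have hterm : ∀ p ∈ c.support, Tendsto (fun m : ℕ =>
      (((r : ℂ) ^ m * (m : ℂ) ^ k)⁻¹ * ((m.choose p.2 : ℂ) * p.1 ^ m) -
        if p ∈ main then (p.1 / r) ^ m * (k.factorial : ℂ)⁻¹ else 0) • c p) atTop (𝓝 0) := by
    rintro ⟨z, j⟩ hzj
    rw [← zero_smul ℂ (c (z, j))]
    refine Tendsto.smul_const ?_ _
    have hform : ∀ m : ℕ, ((r : ℂ) ^ m * (m : ℂ) ^ k)⁻¹ * ((m.choose j : ℂ) * z ^ m) =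
        (z / r) ^ m * (((m.choose j : ℝ) / (m : ℝ) ^ k : ℝ) : ℂ) := by
      intro m
      push_cast
      rw [div_pow, mul_inv]
      ring
    simp only [hform]
    have hle := Prod.Lex.toLex_le_toLex.1 (hmax _ hzj)
    by_cases hin : (z, j) ∈ main
    · obtain ⟨-, h1, h2⟩ := Finset.mem_filter.1 hin
      simp only at h1 h2
      subst h2
      simp only [hin, if_true]
      refine squeeze_zero_norm (a := fun m : ℕ =>
        |(m.choose j : ℝ) / (m : ℝ) ^ j - (j.factorial : ℝ)⁻¹|) (fun m => ?_) ?_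
      · rw [← mul_sub, norm_mul, norm_pow, norm_div, h1, Complex.norm_real, Real.norm_eq_abs,
          abs_of_pos hr, div_self hr.ne', one_pow, one_mul, ← Complex.ofReal_natCast j.factorial,
          ← Complex.ofReal_inv, ← Complex.ofReal_sub, Complex.norm_real, Real.norm_eq_abs]
      · simpa using ((tendsto_choose_div_pow j).sub_const (j.factorial : ℝ)⁻¹).abs
    · simp only [hin, if_false, sub_zero]
      refine squeeze_zero_norm (a := fun m : ℕ =>
        (‖z‖ / r) ^ m * ((m.choose j : ℝ) / (m : ℝ) ^ k)) (fun m => ?_) ?_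
      · rw [norm_mul, norm_pow, norm_div, Complex.norm_real, Real.norm_eq_abs, abs_of_pos hr,
          Complex.norm_real, Real.norm_of_nonneg (by positivity)]
      · rcases hle with hlt | ⟨heq, hjk⟩
        · exact tendsto_pow_mul_choose_div_pow (by positivity) ((div_lt_one hr).2 hlt) j k
        · simp only at heq hjk
          have hjk' : j < k := lt_of_le_of_ne hjk fun h =>
            hin (Finset.mem_filter.2 ⟨hzj, heq, h⟩)
          rw [heq, div_self hr.ne']
          simpa using tendsto_choose_div_pow_of_lt hjk'
  refine ⟨r, hr, k, main.image Prod.fst, fun z => (k.factorial : ℂ)⁻¹ • c (z, k),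
    ⟨z₀, Finset.mem_image.2 ⟨_, Finset.mem_filter.2 ⟨hp, rfl, rfl⟩, rfl⟩⟩, ?_, ?_, ?_⟩
  · intro z hz
    obtain ⟨p, hp', rfl⟩ := Finset.mem_image.1 hz
    obtain ⟨h1, h2, -⟩ := Finset.mem_filter.1 hp'
    exact ⟨(hc p h1).2, h2⟩
  · intro z hz
    obtain ⟨⟨z, j⟩, hp', rfl⟩ := Finset.mem_image.1 hz
    obtain ⟨h1, -, h2⟩ := Finset.mem_filter.1 hp'
    simp only at h2
    subst h2
    exact smul_ne_zero (inv_ne_zero (by exact_mod_cast j.factorial_ne_zero))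
      (Finsupp.mem_support_iff.1 h1)
  · have hsum := tendsto_finsetSum c.support hterm
    rw [Finset.sum_const_zero] at hsum
    refine hsum.congr' ?_
    filter_upwards [hcv] with m hm
    simp only [sub_smul, Finset.sum_sub_distrib]
    rw [hm, Finsupp.sum, Finset.smul_sum]
    congr 1
    · exact Finset.sum_congr rfl fun p _ => by rw [smul_smul]
    · simp only [ite_smul, zero_smul]
      rw [← Finset.sum_filter, Finset.filter_mem_eq_inter,
        Finset.inter_eq_right.2 (Finset.filter_subset _ _), Finset.sum_image]
      · refine Finset.sum_congr rfl fun p hp' => ?_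
        obtain ⟨-, -, h2⟩ := Finset.mem_filter.1 hp'
        rw [← h2, smul_smul]
      · rintro ⟨z, j⟩ h1 ⟨z', j'⟩ h2 h
        have h3 := (Finset.mem_filter.1 h1).2.2
        have h4 := (Finset.mem_filter.1 h2).2.2
        simp only at h h3 h4
        rw [h, h3, h4]

/-! ### Mean zero for functions of trigonometric polynomials. -/

theorem HasMeanZero.congr' {f g : ℕ → ℂ} (hf : HasMeanZero f) (h : f =ᶠ[atTop] g) :
    HasMeanZero g := by
  have h1 : HasMeanZero (g - f) := isLittleO_sum_range_of_tendsto_zero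
    (tendsto_const_nhds.congr' (h.mono fun n hn => by simp [hn]))
  simpa using hf.add h1

/-- The sequences that are linear combinations of `m ↦ u ^ m`, with `u` in the submonoid `S`. -/
def trigPolynomials (S : Submonoid ℂ) : Subalgebra ℂ (ℕ → ℂ) :=
  Algebra.adjoin ℂ (S.map (MonoidHom.pi fun m : ℕ => powMonoidHom m) : Set (ℕ → ℂ))

theorem pow_mem_trigPolynomials {S : Submonoid ℂ} {u : ℂ} (hu : u ∈ S) :
    (fun m : ℕ => u ^ m) ∈ trigPolynomials S :=
  Algebra.subset_adjoin ⟨u, hu, rfl⟩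

/-- The generators are already closed under multiplication, so the algebra is their linear span, and
it suffices to treat `(z * u) ^ m` with `z * u ≠ 1`. -/
theorem hasMeanZero_pow_mul {S : Submonoid ℂ} (hS : ∀ u ∈ S, ‖u‖ = 1) {z : ℂ} (hz : ‖z‖ = 1)
    (hzS : ∀ u ∈ S, z * u ≠ 1) {g : ℕ → ℂ} (hg : g ∈ trigPolynomials S) :
    HasMeanZero fun m => z ^ m * g m := by
  rw [trigPolynomials, ← Subalgebra.mem_toSubmodule, Algebra.adjoin_eq_span,
    Submonoid.closure_eq] at hg
  induction hg using Submodule.span_induction with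
  | mem g hg =>
    obtain ⟨u, hu, rfl⟩ := hg
    have h := hasMeanZero_pow (z := z * u) (by rw [norm_mul, hz, hS u hu, one_mul]) (hzS u hu)
    simp only [mul_pow] at h
    exact h
  | zero =>
    simp only [Pi.zero_apply, mul_zero]
    exact HasMeanZero.zero
  | add f g _ _ hf hg =>
    simp only [Pi.add_apply, mul_add]
    exact hf.add hg
  | smul c g _ hg =>
    convert hg.const_smul c using 1
    ext m
    simp only [Pi.smul_apply, smul_eq_mul]
    ring

theorem exists_complex_polynomial_near {φ : ℝ → ℂ} (hφ : Continuous φ) (a b : ℝ) {ε : ℝ}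
    (hε : 0 < ε) : ∃ p : Polynomial ℂ, ∀ x ∈ Set.Icc a b, ‖φ x - p.eval (x : ℂ)‖ ≤ ε := by
  obtain ⟨p, hp⟩ := exists_polynomial_near_of_continuousOn a b (fun x => (φ x).re)
    (Complex.continuous_re.comp hφ).continuousOn (ε / 2) (by positivity)
  obtain ⟨q, hq⟩ := exists_polynomial_near_of_continuousOn a b (fun x => (φ x).im)
    (Complex.continuous_im.comp hφ).continuousOn (ε / 2) (by positivity)
  refine ⟨p.map Complex.ofRealHom + Polynomial.C Complex.I * q.map Complex.ofRealHom,
    fun x hx => ?_⟩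
  have hev : ∀ s : Polynomial ℝ, (s.map Complex.ofRealHom).eval (x : ℂ) = (s.eval x : ℝ) :=
    fun s => by
      rw [Polynomial.eval_map]
      exact Polynomial.eval₂_at_apply Complex.ofRealHom x
  rw [Polynomial.eval_add, Polynomial.eval_mul, Polynomial.eval_C, hev, hev]
  refine (Complex.norm_le_abs_re_add_abs_im _).trans ?_
  have h1 := hp x hx
  have h2 := hq x hx
  rw [abs_sub_comm] at h1 h2
  simp
  linarith

theorem hasMeanZero_pow_mul_comp {S : Submonoid ℂ} (hS : ∀ u ∈ S, ‖u‖ = 1) {z : ℂ}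
    (hz : ‖z‖ = 1) (hzS : ∀ u ∈ S, z * u ≠ 1) {P : ℕ → ℝ}
    (hP : (fun m => (P m : ℂ)) ∈ trigPolynomials S) {C : ℝ} (hPC : ∀ m, P m ∈ Set.Icc 0 C)
    {φ : ℝ → ℂ} (hφ : Continuous φ) : HasMeanZero fun m => z ^ m * φ (P m) := by
  refine HasMeanZero.of_approx fun ε hε => ?_
  obtain ⟨p, hp⟩ := exists_complex_polynomial_near hφ 0 C hε
  refine ⟨fun m => z ^ m * p.eval (P m : ℂ), hasMeanZero_pow_mul hS hz hzS ?_, ?_⟩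
  · have h1 := Subalgebra.aeval_coe (trigPolynomials S) ⟨_, hP⟩ p
    have h2 : (fun m => p.eval (P m : ℂ)) = Polynomial.aeval (fun m => (P m : ℂ)) p := by
      ext m
      rw [Polynomial.aeval_fn_apply, Polynomial.coe_aeval_eq_eval]
    rw [h2]
    change Polynomial.aeval (fun m => (P m : ℂ)) p = _ at h1
    rw [h1]
    exact Subtype.coe_prop _
  · refine Eventually.of_forall fun M => ?_
    calc _ ≤ ∑ n ∈ Finset.range M, ε := by
          refine Finset.sum_le_sum fun n _ => ?_
          rw [← mul_sub, norm_mul, norm_pow, hz, one_pow, one_mul]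
          exact hp _ (hPC n)
      _ = ε * M := by simp [mul_comm]

theorem abs_log_sub_log_le {δ x y : ℝ} (hδ : 0 < δ) (hx : δ ≤ x) (hy : δ ≤ y) :
    |Real.log x - Real.log y| ≤ |x - y| / δ := by
  have key : ∀ s t : ℝ, δ ≤ s → δ ≤ t → Real.log s - Real.log t ≤ |s - t| / δ := by
    intro s t hs ht
    have hs0 := hδ.trans_le hs
    have ht0 := hδ.trans_le ht
    rw [← Real.log_div hs0.ne' ht0.ne']
    calc Real.log (s / t) ≤ s / t - 1 := Real.log_le_sub_one_of_pos (by positivity)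
      _ = (s - t) / t := by rw [div_sub_one ht0.ne']
      _ ≤ |s - t| / t := by gcongr; exact le_abs_self _
      _ ≤ |s - t| / δ := by gcongr
  rw [abs_le]
  have h1 := key x y hx hy
  have h2 := key y x hy hx
  rw [abs_sub_comm] at h2
  constructor <;> linarith

/-- The oscillating function `exp (i γ log t)` of a perturbed trigonometric polynomial that is
rarely small, times `z ^ m`, has mean zero. -/
theorem hasMeanZero_pow_mul_exp_log {S : Submonoid ℂ} (hS : ∀ u ∈ S, ‖u‖ = 1) {z : ℂ}
    (hz : ‖z‖ = 1) (hzS : ∀ u ∈ S, z * u ≠ 1) {P Q : ℕ → ℝ}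
    (hP : (fun m => (P m : ℂ)) ∈ trigPolynomials S) {C : ℝ} (hPC : ∀ m, P m ∈ Set.Icc 0 C)
    (hsmall : ∀ η > 0, ∃ δ > 0, HasSmallDensity {m | P m < δ} η)
    (hQP : Tendsto (fun m => Q m - P m) atTop (𝓝 0)) (γ : ℝ) :
    HasMeanZero fun m => z ^ m * Complex.exp ((γ * Real.log (Q m) : ℝ) * Complex.I) := by
  refine HasMeanZero.of_approx fun ε hε => ?_
  obtain ⟨δ, hδ, hδE⟩ := hsmall (ε / 4) (by positivity)
  -- Truncating at `δ / 2` makes the function of `P` continuous.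
  refine ⟨fun m => z ^ m * Complex.exp ((γ * Real.log (max (P m) (δ / 2)) : ℝ) * Complex.I),
    hasMeanZero_pow_mul_comp hS hz hzS hP hPC
      (φ := fun t => Complex.exp ((γ * Real.log (max t (δ / 2)) : ℝ) * Complex.I)) ?_, ?_⟩
  · have h1 : Continuous fun t : ℝ => Real.log (max t (δ / 2)) :=
      (continuous_id.max continuous_const).log fun t =>
        (lt_max_of_lt_right (half_pos hδ)).ne'
    fun_prop
  -- The first summand is the Lipschitz constant when `P ≥ δ` and `Q ≥ δ / 2`. The second covers `P
  -- ≥ δ`, `Q < δ / 2`, where `|Q - P| ≥ δ / 2` and the trivial bound `2` suffices. Where `P < δ`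
  -- the indicator pays.
  set K := |γ| / (δ / 2) + 2 / (δ / 2) with hK
  have hpt : ∀ m, ‖z ^ m * Complex.exp ((γ * Real.log (Q m) : ℝ) * Complex.I) -
      z ^ m * Complex.exp ((γ * Real.log (max (P m) (δ / 2)) : ℝ) * Complex.I)‖ ≤
      K * |Q m - P m| + 2 * {m | P m < δ}.indicator (fun _ => (1 : ℝ)) m := by
    intro m
    rw [← mul_sub, norm_mul, norm_pow, hz, one_pow, one_mul]
    have htriv : ‖Complex.exp ((γ * Real.log (Q m) : ℝ) * Complex.I) -
        Complex.exp ((γ * Real.log (max (P m) (δ / 2)) : ℝ) * Complex.I)‖ ≤ 2 := by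
      refine (norm_sub_le _ _).trans ?_
      rw [Complex.norm_exp_ofReal_mul_I, Complex.norm_exp_ofReal_mul_I]
      norm_num
    rw [hK, add_mul]
    have hn1 : 0 ≤ |γ| / (δ / 2) * |Q m - P m| := by positivity
    have hn2 : 0 ≤ 2 / (δ / 2) * |Q m - P m| := by positivity
    by_cases hm : P m < δ
    · rw [Set.indicator_of_mem (show m ∈ {m | P m < δ} from hm)]
      linarith
    · rw [Set.indicator_of_notMem (show m ∉ {m | P m < δ} from hm)]
      rw [not_lt] at hm
      by_cases hq : δ / 2 ≤ Q m
      · refine (norm_exp_mul_I_sub_exp_mul_I_le _ _).trans ?_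
        rw [max_eq_left (by linarith), ← mul_sub, abs_mul]
        have := mul_le_mul_of_nonneg_left
          (abs_log_sub_log_le (half_pos hδ) hq (show δ / 2 ≤ P m by linarith)) (abs_nonneg γ)
        have h3 : |γ| * (|Q m - P m| / (δ / 2)) = |γ| / (δ / 2) * |Q m - P m| := by ring
        linarith
      · rw [not_le] at hq
        have h1 : δ / 2 ≤ |Q m - P m| := by
          rw [abs_sub_comm]
          exact le_trans (by linarith) (le_abs_self _)
        have h2 : 2 ≤ 2 / (δ / 2) * |Q m - P m| := by
          rw [div_mul_eq_mul_div, le_div_iff₀ (half_pos hδ)]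
          linarith
        linarith
  have hces : HasMeanZero fun m => ((K * |Q m - P m| : ℝ) : ℂ) := by
    refine isLittleO_sum_range_of_tendsto_zero ?_
    rw [← Complex.ofReal_zero]
    refine (Complex.continuous_ofReal.tendsto 0).comp ?_
    simpa using hQP.abs.const_mul K
  filter_upwards [hδE, Asymptotics.isLittleO_iff.1 hces (half_pos hε)] with M h1 h2
  refine (Finset.sum_le_sum fun m _ => hpt m).trans ?_
  rw [Finset.sum_add_distrib, ← Finset.mul_sum _ _ (2 : ℝ)]
  rw [← Complex.ofReal_sum, Complex.norm_real, Real.norm_natCast] at h2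
  have := (le_abs_self _).trans h2
  linarith

/-! ### Phases and nonresonance. -/

/-- The complex numbers `exp (2 π i q)` with `q` in an additive monoid of real numbers. -/
noncomputable def phases (Λ : AddSubmonoid ℝ) : Submonoid ℂ where
  carrier := {u | ∃ q ∈ Λ, u = Complex.exp ((2 * Real.pi * q : ℝ) * Complex.I)}
  one_mem' := ⟨0, zero_mem _, by simp⟩
  mul_mem' := by
    rintro _ _ ⟨q, hq, rfl⟩ ⟨s, hs, rfl⟩
    refine ⟨q + s, add_mem hq hs, ?_⟩
    rw [← Complex.exp_add]
    push_cast
    ring_nf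

theorem norm_eq_one_of_mem_phases {Λ : AddSubmonoid ℝ} {u : ℂ} (hu : u ∈ phases Λ) :
    ‖u‖ = 1 := by
  obtain ⟨q, -, rfl⟩ := hu
  exact Complex.norm_exp_ofReal_mul_I _

theorem exists_int_of_exp_eq_one {x : ℝ}
    (h : Complex.exp ((2 * Real.pi * x : ℝ) * Complex.I) = 1) : ∃ n : ℤ, x = n := by
  obtain ⟨n, hn⟩ := Complex.exp_eq_one_iff.1 h
  refine ⟨n, ?_⟩
  have h1 : ((2 * Real.pi * x : ℝ) : ℂ) = ((2 * Real.pi * n : ℝ) : ℂ) := by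
    apply mul_right_cancel₀ Complex.I_ne_zero
    rw [hn]
    push_cast
    ring
  have h2 : 2 * Real.pi * x = 2 * Real.pi * n := Complex.ofReal_injective h1
  exact mul_left_cancel₀ (by positivity) h2

theorem div_norm_eq_exp_arg {z : ℂ} (hz : z ≠ 0) :
    z / ‖z‖ = Complex.exp (Complex.arg z * Complex.I) := by
  have h : (‖z‖ : ℂ) ≠ 0 := by simpa using hz
  rw [div_eq_iff h, mul_comm, Complex.norm_mul_exp_arg_mul_I]

section Nonresonant

variable {b : ℕ} {r : ℝ} {Z : Set ℂ}

theorem IsNonresonantOnCircle.one_mem (h : IsNonresonantOnCircle b r Z) :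
    (1 : ℝ) ∈ argDifferences Z := by
  have : (1 : ℝ) ∈ argDifferences Z ∩ Set.range ((↑) : ℚ → ℝ) := by rw [h.2.2.1]; rfl
  exact this.1

/-- Equal `k`-th powers make the argument difference, over `2π`, equal to some `n / k`. Then `1 + n
/ k` is a rational argument difference, hence `1`, and the arguments agree. -/
theorem IsNonresonantOnCircle.eq_of_pow_eq (h : IsNonresonantOnCircle b r Z) (hr : 0 < r)
    {z w : ℂ} (hz : z ∈ Z) (hw : w ∈ Z) {k : ℕ} (hk : 0 < k) (hzw : (z / r) ^ k = (w / r) ^ k) :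
    z = w := by
  have hz0 : z ≠ 0 := norm_pos_iff.1 (by rw [h.2.1 z hz]; exact hr)
  have hw0 : w ≠ 0 := norm_pos_iff.1 (by rw [h.2.1 w hw]; exact hr)
  have hzr := div_norm_eq_exp_arg hz0
  have hwr := div_norm_eq_exp_arg hw0
  rw [h.2.1 z hz] at hzr
  rw [h.2.1 w hw] at hwr
  rw [hzr, hwr, ← Complex.exp_nat_mul, ← Complex.exp_nat_mul] at hzw
  have h1 : Complex.exp ((2 * Real.pi * (k * ((z.arg - w.arg) / (2 * Real.pi))) : ℝ) * Complex.I)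
      = 1 := by
    have : ((2 * Real.pi * (k * ((z.arg - w.arg) / (2 * Real.pi))) : ℝ) : ℂ) * Complex.I =
        k * (z.arg * Complex.I) - k * (w.arg * Complex.I) := by
      have hpi : (2 * Real.pi : ℝ) ≠ 0 := by positivity
      rw [show 2 * Real.pi * (k * ((z.arg - w.arg) / (2 * Real.pi))) = k * (z.arg - w.arg) by
        field_simp]
      push_cast
      ring
    rw [this, Complex.exp_sub, hzw, div_self (Complex.exp_ne_zero _)]
  obtain ⟨n, hn⟩ := exists_int_of_exp_eq_one h1
  have hk' : (k : ℝ) ≠ 0 := by exact_mod_cast hk.ne'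
  have h2 : 1 + (z.arg - w.arg) / (2 * Real.pi) ∈
      argDifferences Z ∩ Set.range ((↑) : ℚ → ℝ) := by
    refine ⟨⟨z, hz, w, hw, rfl⟩, 1 + n / k, ?_⟩
    push_cast
    rw [← hn, mul_div_cancel_left₀ _ hk']
  rw [h.2.2.1, Set.mem_singleton_iff, add_eq_left, div_eq_zero_iff] at h2
  have h3 : z.arg = w.arg := sub_eq_zero.1 (h2.resolve_right (by positivity))
  exact Complex.ext_norm_arg ((h.2.1 z hz).trans (h.2.1 w hw).symm) h3

/-- The phases `exp (2 π i q)` with `q` in the rational span of the argument differences of `Z`. -/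
noncomputable def ratioPhases (Z : Set ℂ) : Submonoid ℂ :=
  phases (Submodule.span ℚ (argDifferences Z)).toAddSubmonoid

theorem IsNonresonantOnCircle.conj_mul_mem (h : IsNonresonantOnCircle b r Z) (hr : 0 < r)
    {z w : ℂ} (hz : z ∈ Z) (hw : w ∈ Z) :
    (starRingEnd ℂ) (z / r) * (w / r) ∈ ratioPhases Z := by
  have hz0 : z ≠ 0 := norm_pos_iff.1 (by rw [h.2.1 z hz]; exact hr)
  have hw0 : w ≠ 0 := norm_pos_iff.1 (by rw [h.2.1 w hw]; exact hr)
  have hzr := div_norm_eq_exp_arg hz0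
  have hwr := div_norm_eq_exp_arg hw0
  rw [h.2.1 z hz] at hzr
  rw [h.2.1 w hw] at hwr
  refine ⟨(1 + (w.arg - z.arg) / (2 * Real.pi)) - 1, ?_, ?_⟩
  · exact Submodule.sub_mem _ (Submodule.subset_span ⟨w, hw, z, hz, rfl⟩)
      (Submodule.subset_span h.one_mem)
  · rw [hzr, hwr, ← Complex.exp_conj, ← Complex.exp_add]
    congr 1
    have hpi : (2 * Real.pi : ℝ) ≠ 0 := by positivity
    rw [show 2 * Real.pi * ((1 + (w.arg - z.arg) / (2 * Real.pi)) - 1) = w.arg - z.arg by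
      field_simp; ring]
    simp
    ring

/-- Equality would give `k * log_b r + q = n` with `q` in the rational span and `n` an integer.
Since `1` lies in the span, dividing by `k` would put `log_b r` there. -/
theorem IsNonresonantOnCircle.exp_mul_ne_one (h : IsNonresonantOnCircle b r Z) {k : ℤ}
    (hk : k ≠ 0) {u : ℂ} (hu : u ∈ ratioPhases Z) :
    Complex.exp ((2 * Real.pi * (k * Real.logb b r) : ℝ) * Complex.I) * u ≠ 1 := by
  obtain ⟨q, hq, rfl⟩ := hu
  intro h1
  rw [← Complex.exp_add, ← add_mul, ← Complex.ofReal_add, ← mul_add] at h1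
  obtain ⟨n, hn⟩ := exists_int_of_exp_eq_one h1
  refine h.2.2.2 ?_
  have hk' : (k : ℝ) ≠ 0 := by exact_mod_cast hk
  have : Real.logb b r = ((k : ℚ)⁻¹) • (((n : ℚ) • (1 : ℝ)) - q) := by
    simp only [Rat.smul_def]
    push_cast
    rw [mul_one, ← hn]
    field_simp
    ring
  rw [this]
  exact Submodule.smul_mem _ _
    (Submodule.sub_mem _ (Submodule.smul_mem _ _ (Submodule.subset_span h.one_mem)) hq)

end Nonresonant

/-! ### Orbits of a complex linear map with nonresonant spectrum. -/

theorem norm_sq_sum_mem_trigPolynomials {V : Type*} [NormedAddCommGroup V]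
    [InnerProductSpace ℂ V] {S : Submonoid ℂ} (T : Finset ℂ) (u : ℂ → ℂ) (w : ℂ → V)
    (h : ∀ z ∈ T, ∀ z' ∈ T, (starRingEnd ℂ) (u z) * u z' ∈ S) :
    (fun m : ℕ => ((‖∑ z ∈ T, u z ^ m • w z‖ ^ 2 : ℝ) : ℂ)) ∈ trigPolynomials S := by
  have : (fun m : ℕ => ((‖∑ z ∈ T, u z ^ m • w z‖ ^ 2 : ℝ) : ℂ)) =
      ∑ z ∈ T, ∑ z' ∈ T, inner ℂ (w z) (w z') • fun m : ℕ => ((starRingEnd ℂ) (u z) * u z') ^ m := by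
    ext m
    have h1 := inner_self_eq_norm_sq_to_K (𝕜 := ℂ) (∑ z ∈ T, u z ^ m • w z)
    rw [Complex.ofReal_pow]
    refine h1.symm.trans ?_
    simp only [sum_inner, inner_sum, inner_smul_left, inner_smul_right, Finset.sum_apply,
      Pi.smul_apply, smul_eq_mul, map_pow, mul_pow, Finset.mul_sum]
    rw [Finset.sum_comm]
    refine Finset.sum_congr rfl fun z _ => Finset.sum_congr rfl fun z' _ => ?_
    ring
  rw [this]
  exact Subalgebra.sum_mem _ fun z hz => Subalgebra.sum_mem _ fun z' hz' =>
    Subalgebra.smul_mem _ (pow_mem_trigPolynomials (h z hz z' hz')) _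

theorem hasMeanZero_exp_logb_norm {V : Type*} [NormedAddCommGroup V]
    [InnerProductSpace ℂ V] [FiniteDimensional ℂ V] {b : ℕ} (hb : 2 ≤ b)
    (f : Module.End ℂ V) (hf : IsNonresonant b (spectrum ℂ f)) (v : V)
    (hv : ∀ m : ℕ, (f ^ m) v ≠ 0) {h : ℤ} (hh : h ≠ 0) :
    HasMeanZero fun m => Complex.exp (2 * Real.pi * Complex.I * h * Real.logb b ‖(f ^ m) v‖) := by
  obtain ⟨r, hr, k, T, w, hT, hTs, hTw, hlim⟩ := exists_leading_asymptotics f v hv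
  set Z := spectrum ℂ f ∩ {z | ‖z‖ = r} with hZ
  have hTZ : ∀ z ∈ T, z ∈ Z := fun z hz => hTs z hz
  have hnr : IsNonresonantOnCircle b r Z := by
    refine (hf r hr).resolve_right fun h0 => ?_
    obtain ⟨z, hz⟩ := hT
    exact (Set.mem_empty_iff_false z).1 (h0 ▸ hTZ z hz)
  have hb1 : (1 : ℝ) < b := by exact_mod_cast hb
  have hlog : 0 < Real.log b := Real.log_pos hb1
  set F : ℕ → V := fun m => ∑ z ∈ T, (z / r) ^ m • w z with hF
  set G : ℕ → V := fun m => ((r : ℂ) ^ m * (m : ℂ) ^ k)⁻¹ • (f ^ m) v with hG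
  have hunit : ∀ z ∈ T, ‖z / (r : ℂ)‖ = 1 := fun z hz => by
    rw [norm_div, (hTs z hz).2, Complex.norm_real, Real.norm_of_nonneg hr.le, div_self hr.ne']
  have hFbdd : ∀ m, ‖F m‖ ≤ ∑ z ∈ T, ‖w z‖ := fun m => by
    refine (norm_sum_le _ _).trans (Finset.sum_le_sum fun z hz => ?_)
    rw [norm_smul, norm_pow, hunit z hz, one_pow, one_mul]
  set C := ∑ z ∈ T, ‖w z‖ with hC
  have hQP : Tendsto (fun m => ‖G m‖ ^ 2 - ‖F m‖ ^ 2) atTop (𝓝 0) := by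
    have h1 : Tendsto (fun m => ‖G m - F m‖) atTop (𝓝 0) :=
      tendsto_zero_iff_norm_tendsto_zero.1 hlim
    have h2 : Tendsto (fun m => ‖G m - F m‖ * (‖G m - F m‖ + 2 * C)) atTop (𝓝 0) := by
      simpa using h1.mul (h1.add_const (2 * C))
    refine squeeze_zero_norm (fun m => ?_) h2
    rw [Real.norm_eq_abs, sq_sub_sq, abs_mul, mul_comm]
    have h3 : ‖G m‖ ≤ ‖G m - F m‖ + ‖F m‖ := by simpa using norm_add_le (G m - F m) (F m)
    refine mul_le_mul (abs_norm_sub_norm_le _ _) ?_ (abs_nonneg _) (norm_nonneg _)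
    rw [abs_of_nonneg (by positivity)]
    linarith [hFbdd m]
  have hsmall : ∀ η > 0, ∃ δ > 0, HasSmallDensity {m | ‖F m‖ ^ 2 < δ} η := by
    intro η hη
    classical
    have hinj : Set.InjOn (fun z : ℂ => z / r) T := fun z _ z' _ hzz =>
      (div_left_inj' (by exact_mod_cast hr.ne')).1 hzz
    obtain ⟨ε, hε, hd⟩ := exists_hasSmallDensity_norm_sum_lt (T.image fun z => z / (r : ℂ))
      (hT.image _) (by simpa using hunit) (by
        intro u hu u' hu' n hn huu
        obtain ⟨z, hz, rfl⟩ := Finset.mem_image.1 hu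
        obtain ⟨z', hz', rfl⟩ := Finset.mem_image.1 hu'
        rw [hnr.eq_of_pow_eq hr (hTZ z hz) (hTZ z' hz') hn huu])
      (fun u => w (u * r)) (by
        intro u hu
        obtain ⟨z, hz, rfl⟩ := Finset.mem_image.1 hu
        rw [div_mul_cancel₀ _ (by exact_mod_cast hr.ne')]
        exact hTw z hz) hη
    refine ⟨ε ^ 2, by positivity, hd.mono fun m hm => ?_⟩
    have h1 : ‖F m‖ < ε := lt_of_pow_lt_pow_left₀ 2 hε.le hm
    have h2 : ∑ u ∈ T.image (fun z => z / (r : ℂ)), u ^ m • w (u * r) = F m := by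
      rw [Finset.sum_image hinj]
      refine Finset.sum_congr rfl fun z _ => ?_
      rw [div_mul_cancel₀ _ (by exact_mod_cast hr.ne')]
    change ‖∑ u ∈ T.image (fun z => z / (r : ℂ)), u ^ m • w (u * r)‖ < ε
    rwa [h2]
  have hmain := hasMeanZero_pow_mul_exp_log (S := ratioPhases Z)
    (fun u hu => norm_eq_one_of_mem_phases hu)
    (z := Complex.exp ((2 * Real.pi * (h * Real.logb b r) : ℝ) * Complex.I))
    (Complex.norm_exp_ofReal_mul_I _) (fun u hu => hnr.exp_mul_ne_one hh hu)
    (P := fun m => ‖F m‖ ^ 2) (Q := fun m => ‖G m‖ ^ 2)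
    (norm_sq_sum_mem_trigPolynomials T (fun z => z / r) w fun z hz z' hz' =>
      hnr.conj_mul_mem hr (hTZ z hz) (hTZ z' hz'))
    (C := C ^ 2) (fun m => ⟨by positivity, by gcongr; exact hFbdd m⟩) hsmall hQP
    -- Half of `2πh / log b`, because the logarithm is taken of a squared norm.
    (Real.pi * h / Real.log b)
  -- This restores the polynomial factor `m ^ k`.
  refine (hmain.mul_exp_log (2 * Real.pi * h * k / Real.log b)).congr' ?_
  filter_upwards [eventually_gt_atTop 0] with m hm
  have hm' : (0 : ℝ) < m := by exact_mod_cast hm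
  have hnorm : ‖G m‖ = ‖(f ^ m) v‖ / (r ^ m * (m : ℝ) ^ k) := by
    rw [hG]
    simp only
    rw [norm_smul, norm_inv, norm_mul, norm_pow, norm_pow, Complex.norm_real, Complex.norm_natCast,
      Real.norm_of_nonneg hr.le, div_eq_inv_mul]
  have hlogG : Real.log (‖G m‖ ^ 2) =
      2 * (Real.log ‖(f ^ m) v‖ - (m * Real.log r + k * Real.log m)) := by
    rw [hnorm, Real.log_pow, Real.log_div (norm_ne_zero_iff.2 (hv m)) (by positivity),
      Real.log_mul (by positivity) (by positivity), Real.log_pow, Real.log_pow]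
    norm_num
  rw [← Complex.exp_nat_mul, ← Complex.exp_add, ← Complex.exp_add, hlogG]
  congr 1
  have hlogC : (Real.log b : ℂ) ≠ 0 := by exact_mod_cast hlog.ne'
  simp only [Real.logb]
  push_cast
  field_simp
  ring

/-! ### From real matrices to complex linear maps. -/

/-- The inclusion of real into complex Euclidean space. -/
noncomputable def complexify {d : ℕ} (x : EuclideanSpace ℝ (Fin d)) : EuclideanSpace ℂ (Fin d) :=
  WithLp.toLp 2 fun i => (x i : ℂ)

theorem norm_complexify {d : ℕ} (x : EuclideanSpace ℝ (Fin d)) : ‖complexify x‖ = ‖x‖ := by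
  simp [complexify, EuclideanSpace.norm_eq]

theorem toEuclideanLin_complexify {d : ℕ} (A : Matrix (Fin d) (Fin d) ℝ)
    (x : EuclideanSpace ℝ (Fin d)) :
    Matrix.toEuclideanLin (A.map ((↑) : ℝ → ℂ)) (complexify x) =
      complexify (Matrix.toEuclideanLin A x) := by
  ext i
  simp [complexify, Matrix.toLpLin_apply, Matrix.mulVec, dotProduct]

theorem orbit_add {d : ℕ} (A : Matrix (Fin d) (Fin d) ℝ) (x : EuclideanSpace ℝ (Fin d))
    (m n : ℕ) : orbit A x (m + n) = Matrix.toEuclideanLin (A ^ m) (orbit A x n) := by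
  ext i
  simp [orbit, pow_add]

theorem orbit_pow {d : ℕ} (A : Matrix (Fin d) (Fin d) ℝ) (x : EuclideanSpace ℝ (Fin d))
    (N m n : ℕ) : orbit (A ^ N) (orbit A x n) m = orbit A x (N * m + n) := by
  rw [orbit_add, orbit, pow_mul]

theorem complexify_orbit {d : ℕ} (A : Matrix (Fin d) (Fin d) ℝ) (x : EuclideanSpace ℝ (Fin d))
    (m : ℕ) : ((Matrix.toEuclideanLin (A.map ((↑) : ℝ → ℂ)) :
      Module.End ℂ (EuclideanSpace ℂ (Fin d))) ^ m) (complexify x) = complexify (orbit A x m) := by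
  induction m with
  | zero => simp [orbit]
  | succ m ih =>
    rw [pow_succ', Module.End.mul_apply, ih, toEuclideanLin_complexify, add_comm m 1, orbit_add,
      pow_one]

theorem orbit_eq_pow_apply {d : ℕ} (A : Matrix (Fin d) (Fin d) ℝ) (x : EuclideanSpace ℝ (Fin d))
    (m : ℕ) : orbit A x m =
      ((Matrix.toEuclideanLin A : Module.End ℝ (EuclideanSpace ℝ (Fin d))) ^ m) x := by
  induction m with
  | zero => simp [orbit]
  | succ m ih => rw [pow_succ', Module.End.mul_apply, ← ih, add_comm m 1, orbit_add, pow_one]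

theorem isTerminating_of_orbit_eq_zero {d : ℕ} {A : Matrix (Fin d) (Fin d) ℝ}
    {x : EuclideanSpace ℝ (Fin d)} {m : ℕ} (hm : orbit A x m = 0) : IsTerminating A x := by
  intro n hn
  set f : Module.End ℝ (EuclideanSpace ℝ (Fin d)) := Matrix.toEuclideanLin A with hf
  have hrank : Module.finrank ℝ (EuclideanSpace ℝ (Fin d)) = d := finrank_euclideanSpace_fin
  have h1 : x ∈ LinearMap.ker (f ^ (m + n)) := by
    rw [LinearMap.mem_ker, add_comm, pow_add, Module.End.mul_apply, ← orbit_eq_pow_apply A x m,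
      hm, map_zero]
  -- Both `m + n` and `n` are at least the dimension, so the two powers have the same kernel.
  rw [Module.End.ker_pow_eq_ker_pow_finrank_of_le (by omega),
    ← Module.End.ker_pow_eq_ker_pow_finrank_of_le (m := n) (by omega), LinearMap.mem_ker,
    ← orbit_eq_pow_apply] at h1
  exact h1

theorem hasMeanZero_exp_logb_norm_orbit {d b : ℕ} (hb : 2 ≤ b) {A : Matrix (Fin d) (Fin d) ℝ}
    (hA : IsNonresonant b (complexSpectrum A)) {x : EuclideanSpace ℝ (Fin d)}
    (hx : ∀ m, orbit A x m ≠ 0) {h : ℤ} (hh : h ≠ 0) :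
    HasMeanZero fun m =>
      Complex.exp (2 * Real.pi * Complex.I * h * Real.logb b ‖orbit A x m‖) := by
  have h1 := hasMeanZero_exp_logb_norm hb (V := EuclideanSpace ℂ (Fin d))
    (Matrix.toEuclideanLin (A.map ((↑) : ℝ → ℂ)))
    (by rw [Matrix.spectrum_toLpLin]; exact hA) (complexify x)
    (fun m => by
      rw [complexify_orbit, ← norm_ne_zero_iff, norm_complexify, norm_ne_zero_iff]
      exact hx m) hh
  simpa only [complexify_orbit, norm_complexify] using h1

end BenfordLinear

theorem theorem3p7 (d : ℕ) (hd : 0 < d) (A : Matrix (Fin d) (Fin d) ℝ) (b : ℕ) (hb : 2 ≤ b)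
    (hA : ∃ N : ℕ, 0 < N ∧ BenfordLinear.IsNonresonant b (BenfordLinear.complexSpectrum (A ^ N)))
    (x : EuclideanSpace ℝ (Fin d)) :
    BenfordLinear.IsBenford b (fun n => ‖BenfordLinear.orbit A x n‖) ∨
      BenfordLinear.IsTerminating A x := by
  by_cases hx : ∃ m, BenfordLinear.orbit A x m = 0
  · obtain ⟨m, hm⟩ := hx
    exact Or.inr (BenfordLinear.isTerminating_of_orbit_eq_zero hm)
  push Not at hx
  obtain ⟨N, hN, hnr⟩ := hA
  refine Or.inl (BenfordLinear.isBenford_of_hasMeanZero hb (fun n => norm_ne_zero_iff.2 (hx n))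
    fun h hh => ?_)
  simp only [abs_norm]
  refine BenfordLinear.HasMeanZero.of_residue_classes hN (fun n => le_of_eq ?_) fun j _ => ?_
  · have h1 : 2 * (Real.pi : ℂ) * Complex.I * h *
        (Real.logb b ‖BenfordLinear.orbit A x (n + 1)‖ : ℝ) =
        ((2 * Real.pi * h * Real.logb b ‖BenfordLinear.orbit A x (n + 1)‖ : ℝ) : ℂ) *
          Complex.I := by
      push_cast
      ring
    rw [h1, Complex.norm_exp_ofReal_mul_I]
  -- Along `n = N * m + j`, the vector `A ^ (n + 1) x` is `(A ^ N) ^ m` applied to `A ^ (j + 1) x`.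
  · have h1 := BenfordLinear.hasMeanZero_exp_logb_norm_orbit hb hnr
      (x := BenfordLinear.orbit A x (j + 1))
      (fun m => by rw [BenfordLinear.orbit_pow]; exact hx _) hh
    simpa only [BenfordLinear.orbit_pow, ← add_assoc] using h1
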